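/- Let $K$ be an algebraically closed field of characteristic zero, and let $S_d$ be the $K$-vector space of homogeneous polynomials of degree $d$ in two variables $x,y$. The rank of $q\in S_d$ is the least integer $r\ge 0$ such that $q=L_1^d+\dots+L_r^d$ for some linear forms $L_1,\dots,L_r\in S_1$. Let $S_{d,r}\subseteq S_d$ be the set of forms of rank $r$ (so $S_{d,0}=\{0\}$, zero being the empty sum), and let $\overline{S_{d,r}}$ be its Zariski closure in the affine space $S_d$. Let $X\subset\mathbb P(S_d)$ be the rational normal (Veronese) curve, that is, the set of points $[L^d]$ with $0\ne L\in S_1$. A secant $k$-plane to $X$ is a $k$-dimensional projective linear subspace of $\mathbb P(S_d)$ spanned by $k+1$ points of $X$. Then for each integer $k$ with $0\le k\le\left[\frac d2\right]$ we have $$\overline{S_{d,k+1}}\setminus\overline{S_{d,k}}=S_{d,k+1}\cup S_{d,d-k+1}.$$ Moreover, for every $q\in\overline{S_{d,k+1}}\setminus\overline{S_{d,k}}$ (which is necessarily nonzero), the rank of $q$ equals $k+1$ if and only if $[q]$ lies on a secant $k$-plane to $X$; otherwise, the rank of $q$ equals $d-k+1$. -/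

import Mathlib

/-! Binary forms, their rank, Zariski closures of sets of forms, and secant planes of the
rational normal curve. -/

namespace BinaryForm

open scoped LinearAlgebra.Projectivization

/-- The space `S_d` of homogeneous polynomials of degree `d` in two variables `x = X 0`, `y = X 1`. -/
abbrev Forms (K : Type*) [Field K] (d : ℕ) : Submodule K (MvPolynomial (Fin 2) K) :=
  MvPolynomial.homogeneousSubmodule (Fin 2) K d

/-- The `d`-th power `L ^ d` of a linear form, as an element of `S_d`. -/
noncomputable def powForm {K : Type*} [Field K] (d : ℕ) (L : Forms K 1) : Forms K d :=
  ⟨(L : MvPolynomial (Fin 2) K) ^ d, by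
    have h : (L : MvPolynomial (Fin 2) K).IsHomogeneous 1 := L.2
    have h' := h.pow d
    rw [one_mul] at h'
    exact h'⟩

/-- `q` has rank `r`: `r` is the least number such that `q` is a sum of `r` `d`-th powers of
linear forms. -/
def HasRank {K : Type*} [Field K] {d : ℕ} (q : Forms K d) (r : ℕ) : Prop :=
  IsLeast {s : ℕ | ∃ L : Fin s → Forms K 1, q = ∑ i, powForm d (L i)} r

/-- The set `S_{d,r}` of binary forms of degree `d` and rank `r`. In particular `S_{d,0} = {0}`,
zero being the empty sum. -/
def formsOfRank (K : Type*) [Field K] (d r : ℕ) : Set (Forms K d) :=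
  {q | HasRank q r}

/-- The coordinates of a form in `S_d ≅ K^{d+1}`: the coefficients of `x^{d-i} y^i`, `0 ≤ i ≤ d`. -/
noncomputable def coords {K : Type*} [Field K] {d : ℕ} (q : Forms K d) : Fin (d + 1) → K :=
  fun i => MvPolynomial.coeff
    (Finsupp.single 0 (d - (i : ℕ)) + Finsupp.single 1 (i : ℕ)) (q : MvPolynomial (Fin 2) K)

/-- The Zariski closure of a set of forms in the affine space `S_d`: the common zeros of all
polynomials in the coefficients which vanish on the set. -/
def zariskiClosure {K : Type*} [Field K] {d : ℕ} (A : Set (Forms K d)) : Set (Forms K d) :=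
  {q | ∀ F : MvPolynomial (Fin (d + 1)) K,
    (∀ p ∈ A, MvPolynomial.eval (coords p) F = 0) → MvPolynomial.eval (coords q) F = 0}

/-- The Veronese curve (rational normal curve) in `ℙ(S_d)`: the points `[L ^ d]`, where `L` is a
nonzero linear form. -/
def veroneseCurve (K : Type*) [Field K] (d : ℕ) : Set (ℙ K (Forms K d)) :=
  {P | ∃ L : Forms K 1, L ≠ 0 ∧ ∃ h : powForm d L ≠ 0, P = Projectivization.mk K (powForm d L) h}

/-- `W` is a secant `k`-plane of the Veronese curve: a projective subspace spanned by `k + 1`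
independent points of the curve. -/
def IsSecantPlane {K : Type*} [Field K] {d : ℕ} (k : ℕ)
    (W : Projectivization.Subspace K (Forms K d)) : Prop :=
  ∃ P : Fin (k + 1) → ℙ K (Forms K d),
    Projectivization.Independent P ∧ (∀ i, P i ∈ veroneseCurve K d) ∧
      W = Projectivization.Subspace.span (Set.range P)

end BinaryForm

/-
Write `d = m + n`. By apolarity a form `q` of degree `d` pairs `S_m` with `S_n`, the pairing of
`L^d` being evaluation at `L`, so `q` is a combination of the `d`-th powers of `n` given points as
soon as the form of degree `n` with these roots is apolar to `q` (Sylvester). For `2 * n ≤ d + 2`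
the closure of `S_{d,n}` is the set of all `q` with a nonzero apolar form of degree `n`. This
condition is closed because it is the degeneracy of a matrix linear in `q`. Conversely, an apolar
form `g` is moved to `g + t h`, which has distinct roots for almost all `t`. The forms to which
`g + t h` is apolar solve a linear system `A + t B` with `A` surjective, and Cayley-Hamilton turns
the Neumann series for its solution into a polynomial curve through `q`.

If `q` has no nonzero apolar form of degree `k`, then its apolar forms of degree `d - k + 1` have
no common zero, so some of them have distinct roots and the rank of `q` is at most `d - k + 1`. A
decomposition of length at most `d - k` makes every apolar form of degree `k + 1` vanish at all its
points, so a nonzero one forces the length to be at most `k + 1`.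
-/

namespace BinaryForm

open Filter Finset
open scoped LinearAlgebra.Projectivization

section Deformation

open Polynomial

variable {R V W : Type*} [CommRing R] [AddCommGroup V] [Module R V] [AddCommGroup W] [Module R W]

lemma pencil_apply_eval_neumann {A B : V →ₗ[R] W} {N : W →ₗ[R] V} (hN : A ∘ₗ N = LinearMap.id)
    {v : V} (hv : A v = 0) (t : R) (j : ℕ) :
    (A + t • B) (PolynomialModule.eval t (PolynomialModule.single R 0 v -
      ∑ i ∈ range j, PolynomialModule.single R (i + 1) (N (((-(B ∘ₗ N)) ^ i) (B v))))) =
      t ^ (j + 1) • ((-(B ∘ₗ N)) ^ j) (B v) := by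
  have hN' (w : W) : A (N w) = w := LinearMap.congr_fun hN w
  induction j with
  | zero => simp [hv]
  | succ j ih =>
    rw [sum_range_succ, ← sub_sub, map_sub, map_sub, ih, PolynomialModule.eval_single, map_smul,
      LinearMap.add_apply, LinearMap.smul_apply, hN', pow_succ' (-(B ∘ₗ N)), Module.End.mul_apply,
      LinearMap.neg_apply, LinearMap.comp_apply]
    module

/- The `j`-th Neumann partial sum leaves the error `t ^ (j + 1) • (C ^ j) (B v)`. Combining the
partial sums with the coefficients of the characteristic polynomial of `C` cancels the errors. -/
lemma exists_eval_mem_ker_pencil [Module.Free R W] [Module.Finite R W] {A : V →ₗ[R] W}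
    (hA : Function.Surjective A) (B : V →ₗ[R] W) {v : V} (hv : A v = 0) :
    ∃ γ : PolynomialModule R V, PolynomialModule.eval 0 γ = v ∧
      ∀ t : R, (A + t • B) (PolynomialModule.eval t γ) = 0 := by
  obtain ⟨N, hN⟩ := A.exists_rightInverse_of_surjective (LinearMap.range_eq_top.mpr hA)
  set C : Module.End R W := -(B ∘ₗ N) with hC
  set χ := C.charpoly
  let w (j : ℕ) : PolynomialModule R V := PolynomialModule.single R 0 v -
    ∑ i ∈ range j, PolynomialModule.single R (i + 1) (N ((C ^ i) (B v)))
  refine ⟨∑ j ∈ range (χ.natDegree + 1), (monomial (χ.natDegree - j) (χ.coeff j)) • w j, ?_,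
    fun t => ?_⟩
  · have hw (j : ℕ) : PolynomialModule.eval 0 (w j) = v := by simp [w]
    rw [sum_range_succ, map_add, map_sum, sum_eq_zero, PolynomialModule.eval_smul, hw,
      C.charpoly_monic.coeff_natDegree]
    · simp
    · intro j hj
      rw [PolynomialModule.eval_smul, eval_monomial,
        zero_pow (Nat.sub_ne_zero_of_lt (mem_range.mp hj)), mul_zero, zero_smul]
  · calc (A + t • B) (PolynomialModule.eval t (∑ j ∈ range (χ.natDegree + 1), _))
        = ∑ j ∈ range (χ.natDegree + 1), t ^ (χ.natDegree + 1) • χ.coeff j • (C ^ j) (B v) := by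
          rw [map_sum, map_sum]
          refine sum_congr rfl fun j hj => ?_
          rw [PolynomialModule.eval_smul, map_smul, pencil_apply_eval_neumann hN hv, eval_monomial,
            ← hC, smul_smul, smul_smul, mul_assoc, ← pow_add, mul_comm, ← add_assoc,
            Nat.sub_add_cancel (Nat.lt_succ_iff.mp (mem_range.mp hj))]
      _ = t ^ (χ.natDegree + 1) • (aeval C χ) (B v) := by
          rw [← smul_sum, aeval_eq_sum_range, LinearMap.sum_apply]
          rfl
      _ = 0 := by rw [C.aeval_self_charpoly, LinearMap.zero_apply, smul_zero]

end Deformation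

section Pencil

open Polynomial

variable {K : Type*} [Field K] [IsAlgClosed K] [CharZero K]

/- A multiple root of `f + t h` is a root of the Wronskian, and it determines `t`. -/
lemma eventually_separable_pencil {f h : K[X]} (hfh : IsCoprime f h)
    (hh : h.natDegree ≠ 0) : ∀ᶠ t in cofinite, (f + C t * h).Separable := by
  classical
  have hW : wronskian f h ≠ 0 := fun h0 =>
    hh (derivative_eq_zero.mp (hfh.wronskian_eq_zero_iff.mp h0).2)
  refine ((wronskian f h).roots.toFinset.finite_toSet.image
    fun x => -(f.eval x / h.eval x)).subset fun t ht => ?_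
  have ht' : ¬ IsCoprime (f + C t * h) (derivative (f + C t * h)) := ht
  rw [isCoprime_iff_aeval_ne_zero_of_isAlgClosed K K] at ht'
  push Not at ht'
  obtain ⟨x, hx, hx'⟩ := ht'
  simp only [coe_aeval_eq_eval, derivative_add, derivative_C_mul, eval_add, eval_mul, eval_C]
    at hx hx'
  have hhx : h.eval x ≠ 0 := by
    intro h0
    have hfhx := (isCoprime_iff_aeval_ne_zero_of_isAlgClosed K K f h).mp hfh x
    rw [h0, mul_zero, add_zero] at hx
    simp [h0, hx] at hfhx
  refine ⟨x, ?_, ?_⟩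
  · rw [mem_coe, Multiset.mem_toFinset, mem_roots hW, IsRoot.def, wronskian, eval_sub,
      eval_mul, eval_mul]
    linear_combination (derivative h).eval x * hx - h.eval x * hx'
  · field_simp
    linear_combination -hx

lemma eventually_separable_and_natDegree_eq {n : ℕ} {f h : K[X]} (hfh : IsCoprime f h)
    (hf : f.natDegree ≤ n) (hh : h.natDegree ≤ n) (hlead : h.coeff n ≠ 0) :
    ∀ᶠ t in cofinite, (f + C t * h).Separable ∧ (f + C t * h).natDegree = n := by
  have hcoeff : ∀ᶠ t in cofinite, (f + C t * h).coeff n ≠ 0 := by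
    refine (Set.finite_singleton (-(f.coeff n / h.coeff n))).subset fun t ht => ?_
    have ht' : f.coeff n + t * h.coeff n = 0 := by simpa using ht
    rw [Set.mem_singleton_iff]
    field_simp
    linear_combination ht'
  have hdeg : ∀ᶠ t in cofinite, (f + C t * h).natDegree = n := hcoeff.mono fun t ht =>
    natDegree_eq_of_le_of_coeff_ne_zero
      (natDegree_add_le_of_degree_le hf ((natDegree_C_mul_le _ _).trans hh)) ht
  rcases eq_or_ne n 0 with rfl | hn
  · filter_upwards [hcoeff, hdeg] with t ht htdeg
    rw [eq_C_of_natDegree_eq_zero htdeg]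
    exact ⟨(separable_C _).mpr ht.isUnit, natDegree_C _⟩
  · rw [← natDegree_eq_of_le_of_coeff_ne_zero hh hlead] at hn
    exact (eventually_separable_pencil hfh hn).and hdeg

end Pencil

open MvPolynomial

section Coordinates

variable {K : Type*} [Field K] {d : ℕ}

/-- The exponent of `x^{d-i} y^i`, in the form in which it occurs in `coords`. -/
noncomputable def exponent (d i : ℕ) : Fin 2 →₀ ℕ :=
  Finsupp.single 0 (d - i) + Finsupp.single 1 i

lemma degree_exponent (i : Fin (d + 1)) : (exponent d i).degree = d := by
  rw [exponent, map_add, Finsupp.degree_single, Finsupp.degree_single,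
    Nat.sub_add_cancel i.is_le]

lemma exponent_injective (d : ℕ) : Function.Injective (exponent d) := fun i j h => by
  simpa [exponent] using DFunLike.congr_fun h 1

lemma exponent_apply_one {m : Fin 2 →₀ ℕ} (hm : m.degree = d) : exponent d (m 1) = m := by
  rw [Finsupp.degree_eq_sum, Fin.sum_univ_two] at hm
  ext j
  fin_cases j <;> simp [exponent, ← hm]

lemma coords_apply (q : Forms K d) (i : Fin (d + 1)) :
    coords q i = coeff (exponent d i) q.1 := rfl

lemma coeff_sum_monomial_exponent (c : Fin (d + 1) → K) (i : Fin (d + 1)) :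
    coeff (exponent d i) (∑ j : Fin (d + 1), monomial (exponent d j) (c j)) = c i := by
  rw [coeff_sum, sum_eq_single i, coeff_monomial, if_pos rfl]
  · intro j _ hj
    rw [coeff_monomial, if_neg fun h => hj (Fin.ext (exponent_injective d h))]
  · simp

lemma isHomogeneous_sum_monomial_exponent (c : Fin (d + 1) → K) :
    (∑ j : Fin (d + 1), monomial (exponent d j) (c j)).IsHomogeneous d :=
  IsHomogeneous.sum _ _ _ fun j _ => isHomogeneous_monomial _ (degree_exponent j)

lemma sum_monomial_coords (q : Forms K d) :
    ∑ i : Fin (d + 1), monomial (exponent d i) (coords q i) = q.1 := by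
  ext m
  by_cases hm : m.degree = d
  · have hlt : m 1 < d + 1 := Nat.lt_succ_of_le (hm ▸ m.le_degree 1)
    rw [← exponent_apply_one hm]
    exact coeff_sum_monomial_exponent (coords q) ⟨m 1, hlt⟩
  · rw [q.2.coeff_eq_zero hm, (isHomogeneous_sum_monomial_exponent _).coeff_eq_zero hm]

/-- The identification of `S_d` with the affine space `K^{d+1}` given by `coords`. -/
noncomputable def coordsEquiv (K : Type*) [Field K] (d : ℕ) :
    Forms K d ≃ₗ[K] (Fin (d + 1) → K) where
  toFun := coords
  map_add' _ _ := funext fun _ => coeff_add _ _ _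
  map_smul' _ _ := funext fun _ => coeff_smul _ _ _
  invFun c := ⟨_, isHomogeneous_sum_monomial_exponent c⟩
  left_inv q := Subtype.ext (sum_monomial_coords q)
  right_inv c := funext (coeff_sum_monomial_exponent c)

@[simp]
lemma coordsEquiv_apply (q : Forms K d) : coordsEquiv K d q = coords q := rfl

@[simp]
lemma coords_coordsEquiv_symm (c : Fin (d + 1) → K) : coords ((coordsEquiv K d).symm c) = c :=
  (coordsEquiv K d).apply_symm_apply c

instance : FiniteDimensional K (Forms K d) := (coordsEquiv K d).symm.finiteDimensional

lemma finrank_forms (d : ℕ) : Module.finrank K (Forms K d) = d + 1 := by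
  rw [(coordsEquiv K d).finrank_eq, Module.finrank_fin_fun]

lemma eval_eq_sum_coords (p : Forms K d) (v : Fin 2 → K) :
    eval v p.1 = ∑ i : Fin (d + 1), coords p i * (v 0 ^ (d - i : ℕ) * v 1 ^ (i : ℕ)) := by
  conv_lhs => rw [← sum_monomial_coords p]
  simp [eval_monomial, exponent, Finsupp.prod_add_index', pow_add]

lemma coe_powForm (L : Forms K 1) : (powForm d L).1 = L.1 ^ d := rfl

lemma coords_powForm (L : Forms K 1) (i : Fin (d + 1)) :
    coords (powForm d L) i = d.choose i * (coords L 0 ^ (d - i : ℕ) * coords L 1 ^ (i : ℕ)) := by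
  have hL : L.1 = C (coords L 0) * X 0 + C (coords L 1) * X 1 := by
    rw [← sum_monomial_coords L, Fin.sum_univ_two]
    simp [exponent, C_mul_X_eq_monomial]
  have hpow : (powForm d L).1 =
      ∑ j : Fin (d + 1), monomial (exponent d j)
        (d.choose j * (coords L 0 ^ (d - j : ℕ) * coords L 1 ^ (j : ℕ))) := by
    rw [coe_powForm, hL, add_comm, add_pow, ← Fin.sum_univ_eq_sum_range
      (fun j => (_ : MvPolynomial (Fin 2) K) ^ j * _ ^ (d - j) * (d.choose j : _))]
    refine sum_congr rfl fun j _ => ?_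
    rw [monomial_eq]
    simp only [mul_pow, C_mul, map_natCast, C_pow, exponent, pow_zero, implies_true, pow_add,
      Finsupp.prod_add_index', Finsupp.prod_single_index]
    ring
  rw [coords_apply, hpow, coeff_sum_monomial_exponent]

end Coordinates

section Pairing

variable {K : Type*} [Field K] {d : ℕ}

/-- The apolarity pairing, normalised so that pairing with `L ^ d` is evaluation at the
coefficient vector of `L`. It is defined on all polynomials `p`, but sees only the degree `d` part
of `p`. -/
noncomputable def pairing (d : ℕ) : Forms K d →ₗ[K] Module.Dual K (MvPolynomial (Fin 2) K) :=
  (Fintype.linearCombination K fun i : Fin (d + 1) =>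
    (d.choose i : K)⁻¹ • lcoeff K (exponent d i)) ∘ₗ (coordsEquiv K d).toLinearMap

lemma pairing_apply (q p : Forms K d) :
    pairing d q p.1 = ∑ i : Fin (d + 1), coords q i * ((d.choose i : K)⁻¹ * coords p i) := by
  simp [pairing, Fintype.linearCombination_apply, coords_apply, LinearMap.sum_apply]

lemma choose_ne_zero [CharZero K] (i : Fin (d + 1)) : (d.choose i : K) ≠ 0 :=
  Nat.cast_ne_zero.mpr (Nat.choose_pos i.is_le).ne'

lemma pairing_powForm [CharZero K] (L : Forms K 1) (p : Forms K d) :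
    pairing d (powForm d L) p.1 = eval (coords L) p.1 := by
  rw [pairing_apply, eval_eq_sum_coords]
  refine sum_congr rfl fun i _ => ?_
  rw [coords_powForm]
  field_simp [choose_ne_zero (K := K) i]

lemma eq_of_pairing_eq [CharZero K] {q q' : Forms K d}
    (h : ∀ p : Forms K d, pairing d q p.1 = pairing d q' p.1) : q = q' := by
  refine (coordsEquiv K d).injective (funext fun i => ?_)
  have hi := h ((coordsEquiv K d).symm (Pi.single i 1))
  simpa [pairing_apply, Pi.single_apply, (Nat.choose_pos i.is_le).ne'] using hi

lemma exists_pairing_eq [CharZero K] (Λ : Module.Dual K (MvPolynomial (Fin 2) K)) :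
    ∃ q : Forms K d, ∀ p : Forms K d, pairing d q p.1 = Λ p := by
  refine ⟨(coordsEquiv K d).symm fun i => d.choose i * Λ (monomial (exponent d i) 1),
    fun p => ?_⟩
  rw [pairing_apply, ← sum_monomial_coords p, map_sum]
  refine sum_congr rfl fun i _ => ?_
  rw [coords_coordsEquiv_symm, ← mul_one (coords p i), ← smul_eq_mul (coords p i),
    ← smul_monomial, map_smul, smul_eq_mul, smul_eq_mul]
  field_simp [choose_ne_zero (K := K) i]

/-- The catalecticant of `q`, as a bilinear map `S_n × S_m → K`. It is meaningful when
`m + n = d`. -/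
noncomputable def catalecticant (m n : ℕ) :
    Forms K d →ₗ[K] Forms K n →ₗ[K] Module.Dual K (Forms K m) :=
  LinearMap.mk₂ K (fun q g => pairing d q ∘ₗ LinearMap.mulRight K g.1 ∘ₗ (Forms K m).subtype)
    (fun _ _ _ => by ext; simp) (fun _ _ _ => by ext; simp)
    (fun _ _ _ => by ext; simp [mul_add]) (fun _ _ _ => by ext; simp)

@[simp]
lemma catalecticant_apply (m n : ℕ) (q : Forms K d) (g : Forms K n) (p : Forms K m) :
    catalecticant m n q g p = pairing d q (p.1 * g.1) := rfl

/-- The forms of degree `n` apolar to `q`, tested against forms of degree `m`, where `m + n = d`. -/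
noncomputable def apolar (m n : ℕ) (q : Forms K d) : Submodule K (Forms K n) :=
  LinearMap.ker (catalecticant m n q)

lemma mem_apolar {m n : ℕ} {q : Forms K d} {g : Forms K n} :
    g ∈ apolar m n q ↔ ∀ p : Forms K m, pairing d q (p.1 * g.1) = 0 :=
  LinearMap.mem_ker.trans LinearMap.ext_iff

lemma catalecticant_flip_surjective [CharZero K] {m n : ℕ} (hmn : m + n = d) {g : Forms K n}
    (hg : g ≠ 0) : Function.Surjective fun q : Forms K d => catalecticant m n q g := by
  intro ψ
  have hinj : Function.Injective (LinearMap.mulRight K g.1 ∘ₗ (Forms K m).subtype) :=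
    fun p p' hp => Subtype.ext (mul_right_cancel₀ (Submodule.coe_eq_zero.not.mpr hg) hp)
  obtain ⟨Λ, hΛ⟩ := LinearMap.dualMap_surjective_of_injective hinj ψ
  obtain ⟨q, hq⟩ := exists_pairing_eq (d := d) Λ
  refine ⟨q, LinearMap.ext fun p => ?_⟩
  rw [← hΛ, catalecticant_apply]
  exact hq ⟨_, hmn ▸ p.2.mul g.2⟩

lemma exists_deformation_of_mem_apolar [CharZero K] {m n : ℕ} (hmn : m + n = d) {q : Forms K d}
    {g : Forms K n} (hg : g ∈ apolar m n q) (hg0 : g ≠ 0) (h : Forms K n) :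
    ∃ γ : PolynomialModule K (Forms K d), PolynomialModule.eval 0 γ = q ∧
      ∀ t : K, g + t • h ∈ apolar m n (PolynomialModule.eval t γ) := by
  obtain ⟨γ, hγ, hker⟩ := exists_eval_mem_ker_pencil (A := (catalecticant m n).flip g)
    (catalecticant_flip_surjective hmn hg0) ((catalecticant m n).flip h) hg
  refine ⟨γ, hγ, fun t => ?_⟩
  rw [apolar, LinearMap.mem_ker, ← hker t]
  simp

end Pairing

section Points

variable {K : Type*} [Field K] {d n : ℕ}

lemma eval_smul_eq_pow_mul (p : Forms K n) (a : K) (v : Fin 2 → K) :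
    eval (a • v) p.1 = a ^ n * eval v p.1 := by
  rw [eval_eq_sum_coords, eval_eq_sum_coords, mul_sum]
  refine sum_congr rfl fun i _ => ?_
  rw [← pow_sub_mul_pow a i.is_le, Pi.smul_apply, Pi.smul_apply, smul_eq_mul, smul_eq_mul]
  ring

lemma eval_coords_rep_mk_eq_zero_iff {L : Forms K 1} (hL : L ≠ 0) (p : Forms K n) :
    eval (coords (Projectivization.mk K L hL).rep) p.1 = 0 ↔ eval (coords L) p.1 = 0 := by
  obtain ⟨a, ha⟩ := Projectivization.exists_smul_eq_mk_rep K L hL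
  have hcoords : coords (Projectivization.mk K L hL).rep = (a : K) • coords L :=
    ha ▸ map_smul (coordsEquiv K 1) (a : K) L
  rw [hcoords, eval_smul_eq_pow_mul, mul_eq_zero_iff_left (pow_ne_zero _ a.ne_zero)]

lemma exists_coords_ne_zero {L : Forms K 1} (hL : L ≠ 0) : ∃ i, coords L i ≠ 0 :=
  Function.ne_iff.mp ((coordsEquiv K 1).map_ne_zero_iff.mpr hL)

/-- The linear form whose only zero on the projective line is the coefficient vector of `L`. -/
noncomputable def bracket (L : Forms K 1) : Forms K 1 :=
  (coordsEquiv K 1).symm ![coords L 1, -coords L 0]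

lemma eval_bracket (L M : Forms K 1) :
    eval (coords M) (bracket L).1 = coords L 1 * coords M 0 - coords L 0 * coords M 1 := by
  rw [eval_eq_sum_coords, bracket, coords_coordsEquiv_symm]
  simp [Fin.sum_univ_two, sub_eq_add_neg]

lemma eval_bracket_self (L : Forms K 1) : eval (coords L) (bracket L).1 = 0 := by
  rw [eval_bracket, mul_comm, sub_self]

lemma bracket_ne_zero {L : Forms K 1} (hL : L ≠ 0) : bracket L ≠ 0 := by
  obtain ⟨i, hi⟩ := exists_coords_ne_zero hL
  refine (coordsEquiv K 1).symm.map_ne_zero_iff.mpr fun h => hi ?_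
  have h0 : coords L 1 = 0 := congrFun h 0
  have h1 : -coords L 0 = 0 := congrFun h 1
  fin_cases i
  exacts [neg_eq_zero.mp h1, h0]

lemma mk_eq_mk_of_eval_bracket_eq_zero {L M : Forms K 1} (hL : L ≠ 0) (hM : M ≠ 0)
    (h : eval (coords M) (bracket L).1 = 0) :
    Projectivization.mk K M hM = Projectivization.mk K L hL := by
  rw [eval_bracket, sub_eq_zero] at h
  have hdet (i j : Fin 2) : coords M i * coords L j = coords M j * coords L i := by
    fin_cases i <;> fin_cases j <;> first | rfl | (simp only [Fin.zero_eta, Fin.mk_one]; grind)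
  obtain ⟨i, hi⟩ := exists_coords_ne_zero hL
  rw [Projectivization.mk_eq_mk_iff']
  refine ⟨coords M i / coords L i, (coordsEquiv K 1).injective (funext fun j => ?_)⟩
  rw [map_smul, Pi.smul_apply, smul_eq_mul, coordsEquiv_apply, coordsEquiv_apply,
    div_mul_eq_mul_div, div_eq_iff hi, hdet]

lemma exists_eval_eq_one {S : Finset (ℙ K (Forms K 1))} (hS : #S ≤ n) {P : ℙ K (Forms K 1)}
    (hP : P ∉ S) :
    ∃ p : Forms K n, (∀ Q ∈ S, eval (coords Q.rep) p.1 = 0) ∧ eval (coords P.rep) p.1 = 1 := by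
  obtain ⟨i, hi⟩ := exists_coords_ne_zero P.rep_nonzero
  set p : MvPolynomial (Fin 2) K := (∏ Q ∈ S, (bracket Q.rep).1) * X i ^ (n - #S) with hp
  have hpn : p.IsHomogeneous n := by
    have hprod := IsHomogeneous.prod S
      (fun Q => (bracket Q.rep).1) (fun _ => 1) fun Q _ => (bracket Q.rep).2
    simpa [hS] using hprod.mul (isHomogeneous_X_pow (R := K) i (n - #S))
  have hpP : eval (coords P.rep) p ≠ 0 := by
    rw [hp, map_mul, map_prod, map_pow, eval_X]
    refine mul_ne_zero (prod_ne_zero_iff.mpr fun Q hQ h0 => hP ?_) (pow_ne_zero _ hi)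
    rwa [← P.mk_rep, mk_eq_mk_of_eval_bracket_eq_zero Q.rep_nonzero P.rep_nonzero h0, Q.mk_rep]
  refine ⟨(eval (coords P.rep) p)⁻¹ • ⟨p, hpn⟩, fun Q hQ => ?_, ?_⟩
  · have hprod : ∏ R ∈ S, eval (coords Q.rep) (bracket R.rep).1 = 0 :=
      prod_eq_zero hQ (eval_bracket_self _)
    simp only [Submodule.coe_smul, smul_eval, hp, map_mul, map_prod, hprod, zero_mul, mul_zero]
  · simp [smul_eval, hpP]

/-- The point of `ℙ(S_1)` given by `x X + Y`; these are all points but one. -/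
noncomputable def affinePoint (x : K) : ℙ K (Forms K 1) :=
  Projectivization.mk K ((coordsEquiv K 1).symm ![x, 1]) <| by simp

lemma affinePoint_injective : Function.Injective (affinePoint (K := K)) := by
  intro x y h
  obtain ⟨a, ha⟩ := (Projectivization.mk_eq_mk_iff' K _ _ _ _).mp h
  rw [← map_smul, (coordsEquiv K 1).symm.injective.eq_iff] at ha
  have h0 : a * y = x := congrFun ha 0
  have h1 : a * 1 = 1 := congrFun ha 1
  rw [← h0, ← mul_one a, h1, one_mul]

instance [Infinite K] : Infinite (ℙ K (Forms K 1)) := .of_injective _ affinePoint_injective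

lemma exists_ne_zero_eval_eq_zero [Infinite K] {S : Finset (ℙ K (Forms K 1))} (hS : #S ≤ n) :
    ∃ p : Forms K n, p ≠ 0 ∧ ∀ Q ∈ S, eval (coords Q.rep) p.1 = 0 := by
  obtain ⟨P, hP⟩ := Infinite.exists_notMem_finset S
  obtain ⟨p, hpS, hpP⟩ := exists_eval_eq_one hS hP
  exact ⟨p, by rintro rfl; simp at hpP, hpS⟩

end Points

section PowSpan

variable {K : Type*} [Field K] {d m n : ℕ}

/-- The linear combinations of the `d`-th powers of the points of `S`. -/
noncomputable def powSpan (d : ℕ) (S : Finset (ℙ K (Forms K 1))) : Submodule K (Forms K d) :=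
  Submodule.span K ((fun P : ℙ K (Forms K 1) => powForm d P.rep) '' S)

lemma mem_powSpan_iff_exists {S : Finset (ℙ K (Forms K 1))} {q : Forms K d} :
    q ∈ powSpan d S ↔ ∃ c : ℙ K (Forms K 1) → K, ∑ P ∈ S, c P • powForm d P.rep = q :=
  Submodule.mem_span_image_finset_iff_exists_fun' K

lemma powSpan_mono {S T : Finset (ℙ K (Forms K 1))} (h : S ⊆ T) : powSpan d S ≤ powSpan d T :=
  Submodule.span_mono (Set.image_mono (coe_subset.mpr h))

lemma powForm_smul (a : K) (L : Forms K 1) : powForm d (a • L) = a ^ d • powForm d L :=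
  Subtype.ext (smul_pow a L.1 d)

lemma powForm_mem_powSpan {S : Finset (ℙ K (Forms K 1))} {L : Forms K 1} (hL : L ≠ 0)
    (hS : Projectivization.mk K L hL ∈ S) : powForm d L ∈ powSpan d S := by
  obtain ⟨a, ha⟩ := Projectivization.exists_smul_eq_mk_rep K L hL
  have hrep : L = (a⁻¹ : Kˣ) • (Projectivization.mk K L hL).rep := by
    rw [← ha, inv_smul_smul]
  rw [hrep, Units.smul_def, powForm_smul]
  exact Submodule.smul_mem _ _ (Submodule.subset_span (Set.mem_image_of_mem _ hS))

lemma powForm_zero (hd : d ≠ 0) : powForm d (0 : Forms K 1) = 0 := Subtype.ext (zero_pow hd)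

lemma exists_powForm_mem_powSpan_singleton (hd : d ≠ 0) (L : Forms K 1) :
    ∃ P, powForm d L ∈ powSpan d {P} := by
  rcases eq_or_ne L 0 with rfl | hL
  · exact ⟨affinePoint 0, powForm_zero (K := K) hd ▸ zero_mem _⟩
  · exact ⟨_, powForm_mem_powSpan hL (mem_singleton_self _)⟩

variable [CharZero K]

/- Apolarity: by `pairing_powForm`, the forms vanishing on `S` are the annihilator of
`powSpan d S`. -/
lemma mem_powSpan_iff {S : Finset (ℙ K (Forms K 1))} {q : Forms K d} :
    q ∈ powSpan d S ↔
      ∀ p : Forms K d, (∀ P ∈ S, eval (coords P.rep) p.1 = 0) → pairing d q p.1 = 0 := by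
  let Φ : Forms K d →ₗ[K] Module.Dual K (Forms K d) := (Forms K d).subtype.dualMap ∘ₗ pairing d
  have hΦ (P : ℙ K (Forms K 1)) (p : Forms K d) :
      Φ (powForm d P.rep) p = eval (coords P.rep) p.1 :=
    pairing_powForm _ p
  constructor
  · intro hq p hp
    have hle : powSpan d S ≤ LinearMap.ker (Φ.flip p) := by
      rw [powSpan, Submodule.span_le]
      rintro _ ⟨P, hP, rfl⟩
      exact (hΦ P p).trans (hp P hP)
    exact hle hq
  · intro h
    have hmem : Φ q ∈ Submodule.span K (Set.range fun P : S => Φ (powForm d P.1.rep)) := by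
      refine mem_span_of_iInf_ker_le_ker fun p hp => h p fun P hP => ?_
      rw [← hΦ]
      exact (Submodule.mem_iInf _).mp hp ⟨P, hP⟩
    have hrange : (Set.range fun P : S => Φ (powForm d P.1.rep)) =
        Φ '' ((fun P : ℙ K (Forms K 1) => powForm d P.rep) '' S) := by
      ext; simp
    rw [hrange, ← Submodule.map_span] at hmem
    obtain ⟨q', hq', hqq'⟩ := hmem
    rwa [← eq_of_pairing_eq fun p => LinearMap.congr_fun hqq' p]

lemma linearIndependent_powForm_rep {S : Finset (ℙ K (Forms K 1))} (hS : #S ≤ d + 1) :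
    LinearIndependent K fun P : S => powForm d P.1.rep := by
  classical
  have hsep (P : S) := exists_eval_eq_one (n := d) (S := S.erase P) (P := P)
    (by rw [card_erase_of_mem P.2]; omega) (notMem_erase _ _)
  choose p hp0 hp1 using hsep
  refine .of_pairwise_dual_eq_zero_one _ (fun P => (pairing d).flip (p P : MvPolynomial (Fin 2) K))
    (fun P Q hPQ => ?_) fun P => ?_
  · exact (pairing_powForm _ _).trans
      (hp0 P Q (mem_erase.mpr ⟨fun h => hPQ (Subtype.ext h.symm), Q.2⟩))
  · exact (pairing_powForm _ _).trans (hp1 P)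

lemma powSpan_eq_top {S : Finset (ℙ K (Forms K 1))} (hS : d < #S) : powSpan d S = ⊤ := by
  obtain ⟨T, hTS, hT⟩ := exists_subset_card_eq (Nat.succ_le_of_lt hS)
  refine eq_top_mono (powSpan_mono hTS) ?_
  have h := (linearIndependent_powForm_rep hT.le).span_eq_top_of_card_eq_finrank'
    (by rw [Fintype.card_coe, hT, finrank_forms])
  rw [powSpan, ← h]
  congr 1
  ext; simp

lemma eq_zero_of_eval_eq_zero {S : Finset (ℙ K (Forms K 1))} (hS : n < #S) {g : Forms K n}
    (hg : ∀ P ∈ S, eval (coords P.rep) g.1 = 0) : g = 0 := by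
  refine eq_of_pairing_eq fun p => ?_
  have hp : p ∈ powSpan n S := powSpan_eq_top (K := K) hS ▸ Submodule.mem_top
  rw [map_zero, LinearMap.zero_apply, ← mem_powSpan_iff.mp hp g hg, pairing_apply, pairing_apply]
  exact sum_congr rfl fun i _ => by ring

lemma apolar_ne_bot_of_mem_powSpan (hmn : m + n = d) {S : Finset (ℙ K (Forms K 1))}
    (hS : #S ≤ n) {q : Forms K d} (hq : q ∈ powSpan d S) : apolar m n q ≠ ⊥ := by
  obtain ⟨g, hg, hgS⟩ := exists_ne_zero_eval_eq_zero hS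
  refine Submodule.ne_bot_iff _ |>.mpr ⟨g, mem_apolar.mpr fun p => ?_, hg⟩
  refine mem_powSpan_iff.mp hq ⟨_, hmn ▸ p.2.mul g.2⟩ fun P hP => ?_
  rw [map_mul, hgS P hP, mul_zero]

lemma card_le_of_apolar_ne_bot (hmn : m + n = d) {S : Finset (ℙ K (Forms K 1))} (hS : #S ≤ m + 1)
    {c : ℙ K (Forms K 1) → K} (hc : ∀ P ∈ S, c P ≠ 0)
    (h : apolar m n (∑ P ∈ S, c P • powForm d P.rep) ≠ ⊥) : #S ≤ n := by
  classical
  obtain ⟨g, hg, hg0⟩ := Submodule.exists_mem_ne_zero_of_ne_bot h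
  by_contra! hlt
  refine hg0 (eq_zero_of_eval_eq_zero hlt fun P hP => ?_)
  obtain ⟨p, hp0, hp1⟩ := exists_eval_eq_one (n := m) (S := S.erase P) (P := P)
    (by rw [card_erase_of_mem hP]; omega) (notMem_erase _ _)
  have hpair (Q : ℙ K (Forms K 1)) : pairing d (powForm d Q.rep) (p.1 * g.1) =
      eval (coords Q.rep) p.1 * eval (coords Q.rep) g.1 := by
    rw [← map_mul]
    exact pairing_powForm Q.rep ⟨_, hmn ▸ p.2.mul g.2⟩
  have hsum := mem_apolar.mp hg p
  simp only [map_sum, map_smul, LinearMap.sum_apply, LinearMap.smul_apply, hpair,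
    smul_eq_mul] at hsum
  rw [sum_eq_single_of_mem P hP fun Q hQ hQP => by
    rw [hp0 Q (mem_erase.mpr ⟨hQP, hQ⟩), zero_mul, mul_zero], hp1, one_mul] at hsum
  exact (mul_eq_zero.mp hsum).resolve_left (hc P hP)

end PowSpan

section Dehomogenize

open scoped Polynomial

variable {K : Type*} [Field K] {d m n : ℕ}

/-- The dehomogenisation `p(X, 1)` of a binary form, an inverse of `Polynomial.homogenize`. -/
noncomputable def dehomogenize : MvPolynomial (Fin 2) K →ₐ[K] K[X] :=
  aeval ![Polynomial.X, 1]

lemma homogenize_dehomogenize (p : Forms K n) : (dehomogenize p.1).homogenize n = p.1 :=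
  Polynomial.homogenize_eq_of_isHomogeneous p.2 rfl

lemma eval_dehomogenize (p : MvPolynomial (Fin 2) K) (x : K) :
    (dehomogenize p).eval x = eval ![x, 1] p := by
  have h : (Polynomial.aeval x).comp (dehomogenize (K := K)) = aeval ![x, 1] := by
    ext i
    fin_cases i <;> simp [dehomogenize]
  rw [← Polynomial.coe_aeval_eq_eval, ← coe_aeval_eq_eval, ← h]
  rfl

lemma exists_eval_ne_zero [Infinite K] {g : Forms K n} (hg : g ≠ 0) :
    ∃ x : K, eval ![x, 1] g.1 ≠ 0 := by
  by_contra! h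
  refine hg (Subtype.ext ?_)
  rw [← homogenize_dehomogenize g, Polynomial.funext (p := dehomogenize g.1) (q := 0) fun x => ?_]
  · simp
  · rw [eval_dehomogenize, h, Polynomial.eval_zero]

lemma dehomogenize_eq_sum_coords (p : Forms K n) : dehomogenize p.1 =
    ∑ i : Fin (n + 1), Polynomial.monomial (n - i : ℕ) (coords p i) := by
  conv_lhs => rw [← sum_monomial_coords p]
  simp [dehomogenize, aeval_monomial, exponent, Finsupp.prod_add_index', pow_add,
    Polynomial.C_mul_X_pow_eq_monomial]

lemma natDegree_dehomogenize_le (p : Forms K n) : (dehomogenize p.1).natDegree ≤ n := by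
  rw [dehomogenize_eq_sum_coords]
  exact Polynomial.natDegree_sum_le_of_forall_le _ _ fun i _ =>
    (Polynomial.natDegree_monomial_le _).trans (Nat.sub_le _ _)

lemma coeff_dehomogenize (p : Forms K n) : (dehomogenize p.1).coeff n = eval ![1, 0] p.1 := by
  rw [dehomogenize_eq_sum_coords, eval_eq_sum_coords, Polynomial.finsetSum_coeff]
  refine sum_congr rfl fun i _ => ?_
  rw [Polynomial.coeff_monomial]
  rcases eq_or_ne i 0 with rfl | hi
  · simp
  · have hi' : (i : ℕ) ≠ 0 := Fin.val_ne_zero_iff.mpr hi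
    rw [if_neg (by omega)]
    simp [hi']

lemma exists_mul_eq_of_dehomogenize_dvd (hmn : m + n = d) {g : Forms K n}
    (hg : (dehomogenize g.1).natDegree = n) {p : Forms K d}
    (h : dehomogenize g.1 ∣ dehomogenize p.1) : ∃ p' : Forms K m, p'.1 * g.1 = p.1 := by
  subst hmn
  rw [← homogenize_dehomogenize p]
  rcases eq_or_ne (dehomogenize p.1) 0 with h0 | h0
  · exact ⟨0, by simp [h0]⟩
  · obtain ⟨r, hr⟩ := h
    have hle := natDegree_dehomogenize_le p
    rw [hr] at h0 hle
    rw [Polynomial.natDegree_mul (left_ne_zero_of_mul h0) (right_ne_zero_of_mul h0), hg,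
      add_comm, add_le_add_iff_right] at hle
    refine ⟨⟨r.homogenize m, Polynomial.isHomogeneous_homogenize r⟩, ?_⟩
    rw [hr, mul_comm (dehomogenize g.1), Polynomial.homogenize_mul _ _ hle hg.le,
      homogenize_dehomogenize]

lemma eval_coords_rep_affinePoint_eq_zero_iff (p : Forms K n) (x : K) :
    eval (coords (affinePoint x).rep) p.1 = 0 ↔ (dehomogenize p.1).IsRoot x := by
  rw [affinePoint, eval_coords_rep_mk_eq_zero_iff, coords_coordsEquiv_symm, Polynomial.IsRoot.def,
    eval_dehomogenize]

lemma exists_mem_powSpan_of_separable [IsAlgClosed K] [CharZero K] (hmn : m + n = d)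
    {q : Forms K d} {g : Forms K n} (hg : g ∈ apolar m n q)
    (hsep : (dehomogenize g.1).Separable) (hdeg : (dehomogenize g.1).natDegree = n) :
    ∃ S : Finset (ℙ K (Forms K 1)), #S = n ∧ q ∈ powSpan d S := by
  classical
  have hnodup := Polynomial.nodup_roots hsep
  refine ⟨(dehomogenize g.1).roots.toFinset.image affinePoint, ?_,
    mem_powSpan_iff.mpr fun p hp => ?_⟩
  · rw [card_image_of_injective _ affinePoint_injective, Multiset.toFinset_card_of_nodup hnodup,
      ← (IsAlgClosed.splits _).natDegree_eq_card_roots, hdeg]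
  · have hroots : ∀ x ∈ (dehomogenize g.1).roots, (dehomogenize p.1).IsRoot x := fun x hx =>
      (eval_coords_rep_affinePoint_eq_zero_iff p x).mp
        (hp _ (mem_image_of_mem _ (Multiset.mem_toFinset.mpr hx)))
    have hdvd : dehomogenize g.1 ∣ dehomogenize p.1 := by
      rcases eq_or_ne (dehomogenize p.1) 0 with h0 | h0
      · exact h0 ▸ dvd_zero _
      · rw [IsAlgClosed.dvd_iff_roots_le_roots hsep.ne_zero h0, Multiset.le_iff_subset hnodup]
        exact fun x hx => (Polynomial.mem_roots h0).mpr (hroots x hx)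
    obtain ⟨p', hp'⟩ := exists_mul_eq_of_dehomogenize_dvd hmn hdeg hdvd
    rw [← hp']
    exact mem_apolar.mp hg p'

end Dehomogenize

section Generic

variable {K : Type*} [Field K] {d m n : ℕ} {q : Forms K d}

/-- Evaluation at `v`, as a linear functional on the forms of degree `n`. -/
noncomputable def evalForm (n : ℕ) (v : Fin 2 → K) : Module.Dual K (Forms K n) :=
  (aeval v).toLinearMap ∘ₗ (Forms K n).subtype

@[simp]
lemma evalForm_apply (v : Fin 2 → K) (p : Forms K n) : evalForm n v p = eval v p.1 :=
  DFunLike.congr_fun (coe_aeval_eq_eval v) p.1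

/- If evaluation at `v` vanished on these apolar forms, it would be `f ↦ pairing d q (r * f)` for
some `r` of degree `n`. Multiplying `r` by the linear form vanishing at `v` would then give a form
apolar to `q`. -/
lemma exists_mem_apolar_eval_ne_zero (hq : apolar m (n + 1) q = ⊥)
    {v : Fin 2 → K} (hv : v ≠ 0) : ∃ f ∈ apolar n (m + 1) q, evalForm (m + 1) v f ≠ 0 := by
  obtain ⟨L, rfl⟩ := (coordsEquiv K 1).surjective v
  have hL : L ≠ 0 := (coordsEquiv K 1).map_ne_zero_iff.mp hv
  by_contra! hvan
  have hmem : evalForm (m + 1) (coords L) ∈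
      LinearMap.range (catalecticant n (m + 1) q).dualMap := by
    rw [LinearMap.range_dualMap_eq_dualAnnihilator_ker]
    exact (Submodule.mem_dualAnnihilator _).mpr hvan
  obtain ⟨ψ, hψ⟩ := hmem
  obtain ⟨r, rfl⟩ := (Module.evalEquiv K (Forms K n)).surjective ψ
  have hr (f : Forms K (m + 1)) : pairing d q (r.1 * f.1) = eval (coords L) f.1 :=
    (LinearMap.congr_fun hψ f).trans (evalForm_apply _ f)
  have hrL : (⟨r.1 * (bracket L).1, r.2.mul (bracket L).2⟩ : Forms K (n + 1)) ∈
      apolar m (n + 1) q := by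
    refine mem_apolar.mpr fun p => ?_
    rw [mul_left_comm, hr ⟨p.1 * (bracket L).1, p.2.mul (bracket L).2⟩, map_mul,
      eval_bracket_self, mul_zero]
  have hr0 : r.1 = 0 := by
    rw [hq, Submodule.mem_bot] at hrL
    exact (mul_eq_zero.mp (congrArg Subtype.val hrL)).resolve_right
      (Submodule.coe_eq_zero.not.mpr (bracket_ne_zero hL))
  obtain ⟨i, hi⟩ := exists_coords_ne_zero hL
  have hpow := hr ⟨X i ^ (m + 1), isHomogeneous_X_pow i (m + 1)⟩
  rw [hr0, zero_mul, map_zero, map_pow, eval_X] at hpow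
  exact pow_ne_zero _ hi hpow.symm

lemma exists_mem_apolar_forall_eval_ne_zero [Infinite K] (hq : apolar m (n + 1) q = ⊥)
    {ι : Type*} [Finite ι] (v : ι → Fin 2 → K) (hv : ∀ i, v i ≠ 0) :
    ∃ f ∈ apolar n (m + 1) q, ∀ i, eval (v i) f.1 ≠ 0 := by
  simpa only [evalForm_apply] using Module.Dual.exists_forall_mem_ne_zero_of_forall_exists _
    (fun i => evalForm (m + 1) (v i)) fun i => exists_mem_apolar_eval_ne_zero hq (hv i)

variable [CharZero K] [IsAlgClosed K]

lemma eventually_separable_dehomogenize {f h : Forms K n} (h0 : eval ![1, 0] h.1 ≠ 0)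
    (hfh : ∀ x, eval ![x, 1] f.1 ≠ 0 ∨ eval ![x, 1] h.1 ≠ 0) :
    ∀ᶠ t : K in cofinite, (dehomogenize (f + t • h).1).Separable ∧
      (dehomogenize (f + t • h).1).natDegree = n := by
  have hcoprime : IsCoprime (dehomogenize f.1) (dehomogenize h.1) := by
    simpa only [Polynomial.isCoprime_iff_aeval_ne_zero_of_isAlgClosed K K,
      Polynomial.coe_aeval_eq_eval, eval_dehomogenize] using hfh
  refine (eventually_separable_and_natDegree_eq hcoprime (natDegree_dehomogenize_le f)
    (natDegree_dehomogenize_le h) (coeff_dehomogenize h ▸ h0)).mono fun t ht => ?_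
  have hcoe : dehomogenize (f + t • h).1 =
      dehomogenize f.1 + Polynomial.C t * dehomogenize h.1 := by
    simp [Polynomial.smul_eq_C_mul]
  rwa [hcoe]

lemma exists_mem_powSpan_of_apolar_eq_bot (hmn : m + n = d) (hq : apolar m n q = ⊥) :
    ∃ S : Finset (ℙ K (Forms K 1)), #S = m + 1 ∧ q ∈ powSpan d S := by
  rcases n with _ | n
  · obtain ⟨S, hS⟩ := Infinite.exists_subset_card_eq (ℙ K (Forms K 1)) (m + 1)
    exact ⟨S, hS, powSpan_eq_top (K := K) (d := d) (S := S) (by omega) ▸ Submodule.mem_top⟩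
  · obtain ⟨h, hh, hh0⟩ := exists_mem_apolar_forall_eval_ne_zero hq
      (fun _ : Unit => ![1, 0]) (by simp)
    have hroots : {x | eval ![x, 1] h.1 = 0}.Finite := by
      have hne : dehomogenize h.1 ≠ 0 := fun h0 => hh0 () <| by
        rw [← coeff_dehomogenize, h0, Polynomial.coeff_zero]
      simpa only [Polynomial.IsRoot.def, eval_dehomogenize] using
        Polynomial.finite_setOfPred_isRoot hne
    have := hroots.to_subtype
    obtain ⟨f, hf, hf0⟩ := exists_mem_apolar_forall_eval_ne_zero hq
      (fun x : {x | eval ![x, 1] h.1 = 0} => ![x.1, 1]) (by simp)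
    obtain ⟨t, hsep, hdeg⟩ := (eventually_separable_dehomogenize (f := f) (hh0 ())
      fun x => or_iff_not_imp_right.mpr fun hx => hf0 ⟨x, not_not.mp hx⟩).exists
    exact exists_mem_powSpan_of_separable (by omega)
      (Submodule.add_mem _ hf (Submodule.smul_mem _ t hh)) hsep hdeg

end Generic

section Rank

variable {K : Type*} [Field K] [IsAlgClosed K] {d m n r : ℕ} {q : Forms K d}

lemma exists_powForm_eq_smul (hd : d ≠ 0) (c : K) (L : Forms K 1) :
    ∃ M, powForm d M = c • powForm d L := by
  obtain ⟨a, ha⟩ := IsAlgClosed.exists_pow_nat_eq c (Nat.pos_of_ne_zero hd)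
  exact ⟨a • L, by rw [powForm_smul, ha]⟩

lemma exists_eq_sum_powForm_iff (hd : d ≠ 0) :
    (∃ L : Fin r → Forms K 1, q = ∑ i, powForm d (L i)) ↔
      ∃ S : Finset (ℙ K (Forms K 1)), #S = r ∧ q ∈ powSpan d S := by
  classical
  constructor
  · rintro ⟨L, rfl⟩
    choose P hP using fun i => exists_powForm_mem_powSpan_singleton hd (L i)
    obtain ⟨S, hPS, hS⟩ := Infinite.exists_superset_card_eq (univ.image P) r
      (card_image_le.trans_eq (Fintype.card_fin r))
    exact ⟨S, hS, sum_mem fun i _ => powSpan_mono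
      (singleton_subset_iff.mpr (hPS (mem_image_of_mem P (mem_univ i)))) (hP i)⟩
  · rintro ⟨S, hS, hq⟩
    obtain ⟨c, rfl⟩ := mem_powSpan_iff_exists.mp hq
    choose M hM using fun P : ℙ K (Forms K 1) => exists_powForm_eq_smul hd (c P) P.rep
    refine ⟨fun i => M ((S.equivFinOfCardEq hS).symm i), ?_⟩
    simp only [hM]
    rw [← sum_coe_sort, ← (S.equivFinOfCardEq hS).symm.sum_comp]

lemma hasRank_iff (hd : d ≠ 0) : HasRank q r ↔
    IsLeast {s | ∃ S : Finset (ℙ K (Forms K 1)), #S = s ∧ q ∈ powSpan d S} r := by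
  simp only [HasRank, exists_eq_sum_powForm_iff hd]

lemma HasRank.exists_eq_sum (hd : d ≠ 0) (h : HasRank q r) :
    ∃ (S : Finset (ℙ K (Forms K 1))) (c : ℙ K (Forms K 1) → K), #S = r ∧
      (∀ P ∈ S, c P ≠ 0) ∧ ∑ P ∈ S, c P • powForm d P.rep = q := by
  classical
  obtain ⟨⟨S, hS, hq⟩, hmin⟩ := (hasRank_iff hd).mp h
  obtain ⟨c, rfl⟩ := mem_powSpan_iff_exists.mp hq
  refine ⟨S, c, hS, fun P hP hc => ?_, rfl⟩
  have hle := hmin ⟨S.erase P, rfl, mem_powSpan_iff_exists.mpr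
    ⟨c, sum_erase S (by rw [hc, zero_smul])⟩⟩
  exact (card_erase_lt_of_mem hP).not_ge (hS ▸ hle)

lemma exists_hasRank_of_mem_powSpan (hd : d ≠ 0) {S : Finset (ℙ K (Forms K 1))}
    (hq : q ∈ powSpan d S) : ∃ r ≤ #S, HasRank q r := by
  classical
  have hex : ∃ s, ∃ S : Finset (ℙ K (Forms K 1)), #S = s ∧ q ∈ powSpan d S := ⟨_, S, rfl, hq⟩
  exact ⟨Nat.find hex, Nat.find_min' hex ⟨S, rfl, hq⟩,
    (hasRank_iff hd).mpr ⟨Nat.find_spec hex, fun _ => Nat.find_min' hex⟩⟩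

variable [CharZero K]

lemma HasRank.apolar_ne_bot (hmn : m + n = d) (hd : d ≠ 0) (h : HasRank q r) (hr : r ≤ n) :
    apolar m n q ≠ ⊥ := by
  obtain ⟨⟨S, rfl, hq⟩, -⟩ := (hasRank_iff hd).mp h
  exact apolar_ne_bot_of_mem_powSpan hmn hr hq

lemma HasRank.le_of_apolar_ne_bot (hmn : m + n = d) (hd : d ≠ 0) (h : HasRank q r)
    (hr : r ≤ m + 1) (hq : apolar m n q ≠ ⊥) : r ≤ n := by
  obtain ⟨S, c, rfl, hc, rfl⟩ := h.exists_eq_sum hd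
  exact card_le_of_apolar_ne_bot hmn hr hc hq

lemma hasRank_sum (hd : d ≠ 0) {S : Finset (ℙ K (Forms K 1))} (hS : 2 * #S ≤ d + 2)
    {c : ℙ K (Forms K 1) → K} (hc : ∀ P ∈ S, c P ≠ 0) :
    HasRank (∑ P ∈ S, c P • powForm d P.rep) #S := by
  obtain ⟨r, hrS, hr⟩ := exists_hasRank_of_mem_powSpan hd (mem_powSpan_iff_exists.mpr ⟨c, rfl⟩)
  rcases hrS.eq_or_lt with rfl | hlt
  · exact hr
  · have hle := card_le_of_apolar_ne_bot (m := d - r) (by omega) (by omega) hc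
      (hr.apolar_ne_bot (by omega) hd le_rfl)
    omega

lemma hasRank_or_hasRank_iff (hmn : m + (n + 1) = d) (hnm : n ≤ m + 1) :
    HasRank q (n + 1) ∨ HasRank q (m + 2) ↔
      apolar m (n + 1) q ≠ ⊥ ∧ apolar (m + 1) n q = ⊥ := by
  have hd : d ≠ 0 := by omega
  have hmn' : m + 1 + n = d := by omega
  constructor
  · rintro (h | h)
    · refine ⟨h.apolar_ne_bot hmn hd le_rfl, not_not.mp fun hne => ?_⟩
      have hle := h.le_of_apolar_ne_bot hmn' hd (by omega) hne
      omega
    · refine ⟨fun hbot => ?_, not_not.mp fun hne => ?_⟩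
      · obtain ⟨S, hS, hq⟩ := exists_mem_powSpan_of_apolar_eq_bot hmn hbot
        have hle := ((hasRank_iff hd).mp h).2 ⟨S, hS, hq⟩
        omega
      · have hle := h.le_of_apolar_ne_bot hmn' hd (by omega) hne
        omega
  · rintro ⟨hne, hbot⟩
    obtain ⟨S, hS, hq⟩ := exists_mem_powSpan_of_apolar_eq_bot hmn' hbot
    obtain ⟨r, hrS, hr⟩ := exists_hasRank_of_mem_powSpan hd hq
    have hnr : n < r := by
      by_contra! hle
      exact hr.apolar_ne_bot hmn' hd hle hbot
    have hrn : r ≤ m + 1 → r ≤ n + 1 := fun hle => hr.le_of_apolar_ne_bot hmn hd hle hne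
    obtain rfl | rfl : r = n + 1 ∨ r = m + 2 := by omega
    exacts [.inl hr, .inr hr]

end Rank

section ZariskiClosure

open scoped Polynomial

variable {K : Type*} [Field K] {d m r : ℕ} {A : Set (Forms K d)} {q : Forms K d}

lemma subset_zariskiClosure (A : Set (Forms K d)) : A ⊆ zariskiClosure A := fun _ hp _ hF => hF _ hp

lemma exists_polynomial_eval_eq (γ : PolynomialModule K (Forms K d))
    (F : MvPolynomial (Fin (d + 1)) K) :
    ∃ Q : K[X], ∀ t, Q.eval t = eval (coords (PolynomialModule.eval t γ)) F := by
  let c (i : Fin (d + 1)) : K[X] := PolynomialModule.equivPolynomialSelf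
    (PolynomialModule.map K (LinearMap.proj i ∘ₗ (coordsEquiv K d).toLinearMap) γ)
  have hc (t : K) (i : Fin (d + 1)) :
      (c i).eval t = coords (PolynomialModule.eval t γ) i := by
    change Polynomial.aeval t (PolynomialModule.equivPolynomial _) = _
    rw [PolynomialModule.aeval_equivPolynomial, PolynomialModule.eval_map']
    exact PolynomialModule.eval_map K _ γ t
  refine ⟨aeval c F, fun t => ?_⟩
  have h : (Polynomial.aeval t).comp (aeval (R := K) c) =
      aeval (coords (PolynomialModule.eval t γ)) := by
    ext i
    simp [hc]
  rw [← Polynomial.coe_aeval_eq_eval, ← coe_aeval_eq_eval, ← h]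
  rfl

lemma eval_zero_mem_zariskiClosure [Infinite K] {γ : PolynomialModule K (Forms K d)}
    (h : ∀ᶠ t in cofinite, PolynomialModule.eval t γ ∈ zariskiClosure A) :
    PolynomialModule.eval 0 γ ∈ zariskiClosure A := by
  intro F hF
  obtain ⟨Q, hQ⟩ := exists_polynomial_eval_eq γ F
  have hQ0 : Q = 0 := Q.eq_zero_of_infinite_isRoot <| by
    refine frequently_cofinite_iff_infinite.mp (h.mono fun t ht => ?_).frequently
    exact (hQ t).trans (ht F hF)
  rw [← hQ, hQ0, Polynomial.eval_zero]

lemma exists_eval_eq_det {V : Type*} [AddCommGroup V] [Module K V] [FiniteDimensional K V]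
    (ψ : Forms K d →ₗ[K] Module.End K V) :
    ∃ F : MvPolynomial (Fin (d + 1)) K, ∀ p, eval (coords p) F = LinearMap.det (ψ p) := by
  let b := Module.Basis.ofEquivFun (coordsEquiv K d)
  refine ⟨C ((-1) ^ Module.finrank K V) * (LinearMap.polyCharpoly ψ b).coeff 0, fun p => ?_⟩
  have h := LinearMap.polyCharpoly_coeff_eval ψ b p 0
  have hp : (b.repr p : Fin (d + 1) → K) = coords p :=
    funext fun i => Module.Basis.ofEquivFun_repr_apply _ p i
  rw [LinearMap.det_eq_sign_charpoly_coeff, map_mul, eval_C, ← h, hp]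

lemma ker_ne_bot_of_mem_zariskiClosure {V W : Type*} [AddCommGroup V] [Module K V]
    [FiniteDimensional K V] [AddCommGroup W] [Module K W]
    (φ : Forms K d →ₗ[K] V →ₗ[K] Module.Dual K W)
    (hA : ∀ p ∈ A, LinearMap.ker (φ p) ≠ ⊥) (hq : q ∈ zariskiClosure A) :
    LinearMap.ker (φ q) ≠ ⊥ := by
  intro hbot
  obtain ⟨N, hN⟩ := (φ q).exists_leftInverse_of_injective hbot
  obtain ⟨F, hF⟩ := exists_eval_eq_det (LinearMap.llcomp K V (Module.Dual K W) V N ∘ₗ φ)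
  have hdet : LinearMap.det (N ∘ₗ φ q) = 0 := (hF q).symm.trans <| hq F fun p hp => by
    rw [hF, LinearMap.det_eq_zero_iff_ker_ne_bot]
    exact ne_bot_of_le_ne_bot (hA p hp) (LinearMap.ker_le_ker_comp (φ p) N)
  rw [hN, LinearMap.det_id] at hdet
  exact one_ne_zero hdet

lemma exists_forall_eval_eq_pow (r : ℕ) (c : K) :
    ∃ h : Forms K r, ∀ v, eval v h.1 = (v 0 - c * v 1) ^ r :=
  ⟨powForm r (bracket ((coordsEquiv K 1).symm ![c, 1])), fun v => by
    obtain ⟨M, rfl⟩ := (coordsEquiv K 1).surjective v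
    rw [coe_powForm, map_pow, coordsEquiv_apply, eval_bracket, coords_coordsEquiv_symm]
    simp⟩

variable [IsAlgClosed K] [CharZero K]

lemma mem_zariskiClosure_formsOfRank_of_mem_powSpan (hd : d ≠ 0)
    {S : Finset (ℙ K (Forms K 1))} (hS : 2 * #S ≤ d + 2) (hq : q ∈ powSpan d S) :
    q ∈ zariskiClosure (formsOfRank K d #S) := by
  obtain ⟨c, rfl⟩ := mem_powSpan_iff_exists.mp hq
  set γ : PolynomialModule K (Forms K d) := ∑ P ∈ S,
    (PolynomialModule.single K 0 (c P • powForm d P.rep) +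
      PolynomialModule.single K 1 (powForm d P.rep)) with hγ
  have heval (t : K) : PolynomialModule.eval t γ = ∑ P ∈ S, (c P + t) • powForm d P.rep := by
    simp [hγ, add_smul]
  have hgen : ∀ᶠ t in cofinite, ∀ P ∈ S, c P + t ≠ 0 :=
    (Filter.eventually_all_finset S).mpr fun P _ =>
      (Set.finite_singleton (-c P)).subset fun t ht =>
        eq_neg_of_add_eq_zero_right (not_not.mp ht)
  have hzero : PolynomialModule.eval 0 γ = ∑ P ∈ S, c P • powForm d P.rep := by
    simp only [heval, add_zero]
  rw [← hzero]
  refine eval_zero_mem_zariskiClosure (hgen.mono fun t ht => subset_zariskiClosure _ ?_)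
  rw [heval]
  exact hasRank_sum hd hS ht

lemma mem_zariskiClosure_formsOfRank_of_apolar_ne_bot (hmr : m + r = d) (hd : d ≠ 0)
    (hrm : r ≤ m + 2) (hq : apolar m r q ≠ ⊥) : q ∈ zariskiClosure (formsOfRank K d r) := by
  obtain ⟨g, hg, hg0⟩ := Submodule.exists_mem_ne_zero_of_ne_bot hq
  obtain ⟨c, hc⟩ := exists_eval_ne_zero hg0
  obtain ⟨h, hh⟩ := exists_forall_eval_eq_pow r c
  obtain ⟨γ, hγ0, hγ⟩ := exists_deformation_of_mem_apolar hmr hg hg0 h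
  have hsep := eventually_separable_dehomogenize (f := g) (h := h) (by simp [hh]) fun x => by
    rcases eq_or_ne x c with rfl | hx
    · exact .inl hc
    · exact .inr (by simpa [hh] using pow_ne_zero r (sub_ne_zero.mpr hx))
  rw [← hγ0]
  refine eval_zero_mem_zariskiClosure (hsep.mono fun t ht => ?_)
  obtain ⟨S, hS, hqS⟩ := exists_mem_powSpan_of_separable hmr (hγ t) ht.1 ht.2
  rw [← hS]
  exact mem_zariskiClosure_formsOfRank_of_mem_powSpan hd (by omega) hqS

lemma mem_zariskiClosure_formsOfRank_iff (hmr : m + r = d) (hd : d ≠ 0) (hrm : r ≤ m + 2) :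
    q ∈ zariskiClosure (formsOfRank K d r) ↔ apolar m r q ≠ ⊥ :=
  ⟨ker_ne_bot_of_mem_zariskiClosure (catalecticant m r) fun _ hp =>
      HasRank.apolar_ne_bot hmr hd hp le_rfl,
    mem_zariskiClosure_formsOfRank_of_apolar_ne_bot hmr hd hrm⟩

end ZariskiClosure

section SecantPlanes

open Projectivization

variable {K : Type*} [Field K] {d k : ℕ} {W : Projectivization.Subspace K (Forms K d)}
  {q : Forms K d}

lemma exists_isSecantPlane_of_mem_powSpan [CharZero K] (hk : k ≤ d) {S : Finset (ℙ K (Forms K 1))}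
    (hS : #S = k + 1) (hq : q ≠ 0) (hqS : q ∈ powSpan d S) :
    ∃ W : Projectivization.Subspace K (Forms K d), IsSecantPlane k W ∧ mk K q hq ∈ W := by
  have hli : LinearIndependent K fun P : S => powForm d P.1.rep :=
    linearIndependent_powForm_rep (by omega)
  let e := (S.equivFinOfCardEq hS).symm
  have hli' := hli.comp e e.injective
  let P (i : Fin (k + 1)) : ℙ K (Forms K d) := mk K _ (hli'.ne_zero i)
  refine ⟨Projectivization.Subspace.span (Set.range P), ⟨P, .mk _ hli'.ne_zero hli',
    fun i => ⟨_, rep_nonzero _, hli'.ne_zero i, rfl⟩, rfl⟩, ?_⟩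
  obtain ⟨c, rfl⟩ := mem_powSpan_iff_exists.mp hqS
  rw [← Projectivization.Subspace.mem_submodule_iff]
  refine sum_mem fun Q hQ => Submodule.smul_mem _ _ ?_
  obtain ⟨i, hi⟩ := e.surjective ⟨Q, hQ⟩
  have hPi := Projectivization.Subspace.subset_span _ (Set.mem_range_self (f := P) i)
  simpa [P, hi, ← Projectivization.Subspace.mem_submodule_iff] using hPi

lemma IsSecantPlane.exists_mem_powSpan [Infinite K] (hW : IsSecantPlane k W)
    (hq : q ≠ 0) (hqW : mk K q hq ∈ W) :
    ∃ S : Finset (ℙ K (Forms K 1)), #S = k + 1 ∧ q ∈ powSpan d S := by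
  classical
  obtain ⟨P, -, hP, rfl⟩ := hW
  choose L hL h0 hPL using hP
  obtain ⟨S, hLS, hS⟩ := Infinite.exists_superset_card_eq
    (univ.image fun i => mk K (L i) (hL i)) (k + 1) (card_image_le.trans_eq (Fintype.card_fin _))
  have hle : Projectivization.Subspace.span (Set.range P) ≤ (powSpan d S).projectivization := by
    rw [Projectivization.Subspace.span_le_subspace_iff]
    rintro _ ⟨i, rfl⟩
    rw [hPL i, SetLike.mem_coe, Submodule.mk_mem_projectivization_iff]
    exact powForm_mem_powSpan (hL i) (hLS (mem_image_of_mem _ (mem_univ i)))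
  exact ⟨S, hS, (Submodule.mk_mem_projectivization_iff _ hq).mp (hle hqW)⟩

lemma exists_isSecantPlane_iff [CharZero K] (hk : k ≤ d) (hq : q ≠ 0) :
    (∃ W : Projectivization.Subspace K (Forms K d), IsSecantPlane k W ∧ mk K q hq ∈ W) ↔
      ∃ S : Finset (ℙ K (Forms K 1)), #S = k + 1 ∧ q ∈ powSpan d S :=
  ⟨fun ⟨_, hW, hqW⟩ => hW.exists_mem_powSpan hq hqW,
    fun ⟨_, hS, hqS⟩ => exists_isSecantPlane_of_mem_powSpan hk hS hq hqS⟩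

end SecantPlanes

section DegreeZero

variable {K : Type*} [Field K] {r : ℕ} {q : Forms K 0}

lemma coords_powForm_degree_zero (L : Forms K 1) : coords (powForm 0 L) 0 = 1 := by
  simp [coords_powForm]

lemma eq_sum_powForm_degree_zero_iff {L : Fin r → Forms K 1} :
    q = ∑ i, powForm 0 (L i) ↔ coords q 0 = r := by
  rw [← (coordsEquiv K 0).injective.eq_iff, funext_iff, Fin.forall_fin_one, map_sum,
    Finset.sum_apply]
  simp [coords_powForm_degree_zero]

lemma hasRank_degree_zero_iff [CharZero K] : HasRank q r ↔ coords q 0 = r := by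
  simp only [HasRank, eq_sum_powForm_degree_zero_iff, exists_const]
  exact ⟨fun h => h.1, fun h => ⟨h, fun s hs => (Nat.cast_injective (h.symm.trans hs)).le⟩⟩

lemma mem_zariskiClosure_degree_zero_iff [CharZero K] :
    q ∈ zariskiClosure (formsOfRank K 0 r) ↔ HasRank q r := by
  refine ⟨fun h => ?_, fun h => subset_zariskiClosure _ h⟩
  have hq := h (X 0 - C (r : K)) fun p hp => by
    rw [map_sub, eval_X, eval_C, hasRank_degree_zero_iff.mp hp, sub_self]
  rwa [map_sub, eval_X, eval_C, sub_eq_zero, ← hasRank_degree_zero_iff] at hq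

end DegreeZero

section Sylvester

variable {K : Type*} [Field K] [IsAlgClosed K] [CharZero K] {d k : ℕ} {q : Forms K d}

lemma mem_zariskiClosure_sdiff_iff (hk : k ≤ d / 2) :
    q ∈ zariskiClosure (formsOfRank K d (k + 1)) \ zariskiClosure (formsOfRank K d k) ↔
      HasRank q (k + 1) ∨ HasRank q (d - k + 1) := by
  rw [Set.mem_sdiff]
  rcases eq_or_ne d 0 with rfl | hd
  · obtain rfl : k = 0 := by omega
    simp only [mem_zariskiClosure_degree_zero_iff, hasRank_degree_zero_iff, or_self]
    exact and_iff_left_of_imp fun h => by simp [h]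
  · obtain ⟨m, rfl⟩ : ∃ m, d = m + (k + 1) := Nat.exists_eq_add_of_le' (by omega)
    rw [mem_zariskiClosure_formsOfRank_iff rfl hd (by omega),
      mem_zariskiClosure_formsOfRank_iff (m := m + 1) (by omega) hd (by omega), not_not,
      ← hasRank_or_hasRank_iff rfl (by omega), show m + (k + 1) - k + 1 = m + 2 by omega]

lemma hasRank_succ_iff_exists_mem_powSpan (hk : k ≤ d / 2)
    (hq : HasRank q (k + 1) ∨ HasRank q (d - k + 1)) :
    HasRank q (k + 1) ↔ ∃ S : Finset (ℙ K (Forms K 1)), #S = k + 1 ∧ q ∈ powSpan d S := by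
  rcases eq_or_ne d 0 with rfl | hd
  · obtain rfl : k = 0 := by omega
    exact iff_of_true (or_self_iff.mp hq)
      ⟨{affinePoint 0}, card_singleton _, by rw [powSpan_eq_top (by simp)]; exact Submodule.mem_top⟩
  · refine ⟨fun h => ((hasRank_iff hd).mp h).1, fun hS => hq.elim id fun h => ?_⟩
    have hle := ((hasRank_iff hd).mp h).2 hS
    rwa [show d - k + 1 = k + 1 by omega] at h

end Sylvester

end BinaryForm

theorem theorem2 {K : Type*} [Field K] [IsAlgClosed K] [CharZero K] (d k : ℕ) (hk : k ≤ d / 2) :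
    BinaryForm.zariskiClosure (BinaryForm.formsOfRank K d (k + 1)) \
        BinaryForm.zariskiClosure (BinaryForm.formsOfRank K d k) =
      BinaryForm.formsOfRank K d (k + 1) ∪ BinaryForm.formsOfRank K d (d - k + 1) ∧
    ∀ (q : BinaryForm.Forms K d) (hq : q ≠ 0),
      q ∈ BinaryForm.zariskiClosure (BinaryForm.formsOfRank K d (k + 1)) \
        BinaryForm.zariskiClosure (BinaryForm.formsOfRank K d k) →
      (BinaryForm.HasRank q (k + 1) ↔
        ∃ W : Projectivization.Subspace K (BinaryForm.Forms K d),
          BinaryForm.IsSecantPlane k W ∧ Projectivization.mk K q hq ∈ W) ∧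
      ((¬ ∃ W : Projectivization.Subspace K (BinaryForm.Forms K d),
          BinaryForm.IsSecantPlane k W ∧ Projectivization.mk K q hq ∈ W) →
        BinaryForm.HasRank q (d - k + 1)) := by
  open BinaryForm in
  refine ⟨Set.ext fun q => mem_zariskiClosure_sdiff_iff hk, fun q hq hmem => ?_⟩
  have hrank := (mem_zariskiClosure_sdiff_iff hk).mp hmem
  have hsecant : HasRank q (k + 1) ↔ ∃ W : Projectivization.Subspace K (Forms K d),
      IsSecantPlane k W ∧ Projectivization.mk K q hq ∈ W :=
    (hasRank_succ_iff_exists_mem_powSpan hk hrank).trans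
      (exists_isSecantPlane_iff (by omega) hq).symm
  exact ⟨hsecant, fun hW => hrank.resolve_left fun h => hW (hsecant.mp h)⟩
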